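/- Let $n\ge 1$ and $d\ge 1$ be integers and let $J$ be a countable set. For each $j\in J$, let $m_j$ be a positive integer, and let $P_j$ be a polynomial in $nm_j$ variables with rational coefficients, not identically zero, of total degree at most $d$. For $x_1,\ldots,x_{m_j}\in\mathbb{R}^n$, write $P_j(x_1,\ldots,x_{m_j})$ for the value of $P_j$ at the coordinates $(x_{1,1},\ldots,x_{1,n},\ldots,x_{m_j,1},\ldots,x_{m_j,n})$. Then there exists a compact set $E\subset\mathbb{R}^n$ of Hausdorff dimension $n/d$ such that for every $j\in J$, $E$ does not contain $m_j$ distinct points $x_1,\ldots,x_{m_j}$ satisfying $P_j(x_1,\ldots,x_{m_j})=0$. -/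

import Mathlib

open scoped ENNReal

/-!
Whether `P` vanishes at a tuple of points is controlled by arithmetic near rational grids: if `P`
has rational coefficients and degree at most `d`, its values on `N⁻¹ ℤⁿ` are integer multiples of
`1 / (c * N ^ d)` with `c` independent of `N`. Suppose that a partial derivative of `P` along a
coordinate of one of the points does not vanish at a given tuple of distinct points. Move the grid
points near that one point by a small multiple of `N ^ (-d)` in that coordinate direction, and
surround all grid points by cubes whose side is a much smaller multiple of `N ^ (-d)`. At a tuple
taken from these cubes near the given one, `P` is nonzero: if its value at the unmoved grid points
is nonzero, it is too large to be cancelled, and if it is zero, the shift produces a nonzero value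
(`PerturbedGrid.exists_forall_aeval_ne_zero`).

The assumption on the derivative is harmless, because a zero of `P` is a zero with nonvanishing
gradient of some iterated partial derivative of `P`, whose degree is still at most `d`
(`MvPolynomial.exists_aeval_eq_zero_pderiv_ne_zero`). It therefore suffices to treat all rational
polynomials of degree at most `d`, in any number of points, and by the Lindelöf property countably
many perturbed grids are enough (`PerturbedGrid.exists_seq`).

The set is a Cantor set whose `k`-th generation consists of cubes of the `k`-th perturbed grid, with
`N = N_k` growing very fast (`PerturbedGrid.exists_isCompact_subset_cells`). It is covered by
`N ^ n` cubes of side at most `N ^ (-d)`, so its dimension is at most `n / d`. Conversely, points of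
it are coded by mixed-radix expansions of points of `[0, 1)ⁿ`, and the decoding map is Hölder continuous
with every exponent `r < 1 / d` (`PerturbedGrid.exists_dist_le_mul_rpow`); as its image
`[0, 1)ⁿ` has dimension `n`, the dimension of the Cantor set is at least `r * n`.
-/

open Filter Topology MeasureTheory

/-! ### Rational polynomials at grid points, and regular zeros -/

namespace MvPolynomial

variable {ι : Type*}

/-- At points of `N⁻¹ ℕ ^ ι`, the values of a rational polynomial of degree at most `d` are integer
multiples of `1 / (c * N ^ d)`, where `c` does not depend on `N`: take the product of the
denominators of the coefficients. -/
theorem exists_pos_mul_pow_mul_aeval_eq_intCast (Q : MvPolynomial ι ℚ) {d : ℕ}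
    (hQ : Q.totalDegree ≤ d) :
    ∃ c : ℕ, 0 < c ∧ ∀ (N : ℕ), 0 < N → ∀ q : ι → ℕ, ∃ z : ℤ,
      (c : ℝ) * (N : ℝ) ^ d * aeval (fun i => (q i : ℝ) / N) Q = z := by
  classical
  refine ⟨∏ s ∈ Q.support, (Q.coeff s).den, Finset.prod_pos fun s _ => (Q.coeff s).den_pos, ?_⟩
  intro N hN q
  have hN' : (N : ℝ) ≠ 0 := by positivity
  have key : ∀ s ∈ Q.support, ∃ z : ℤ, ((∏ s ∈ Q.support, (Q.coeff s).den : ℕ) : ℝ) * (N : ℝ) ^ d *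
      (((Q.coeff s : ℚ) : ℝ) * ∏ i ∈ s.support, ((q i : ℝ) / N) ^ s i) = z := by
    intro s hs
    have hsd : ∑ i ∈ s.support, s i ≤ d := (le_totalDegree hs).trans hQ
    refine ⟨(∏ u ∈ Q.support.erase s, (Q.coeff u).den : ℕ) * (Q.coeff s).num *
      (N ^ (d - ∑ i ∈ s.support, s i) : ℕ) * (∏ i ∈ s.support, q i ^ s i : ℕ), ?_⟩
    have h1 : ((Q.coeff s).den : ℝ) * ((Q.coeff s : ℚ) : ℝ) = (Q.coeff s).num := by
      exact_mod_cast Rat.den_mul_eq_num (Q.coeff s)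
    have h2 : (N : ℝ) ^ d =
        (N : ℝ) ^ (d - ∑ i ∈ s.support, s i) * ∏ i ∈ s.support, (N : ℝ) ^ s i := by
      rw [Finset.prod_pow_eq_pow_sum, ← pow_add, Nat.sub_add_cancel hsd]
    have h3 : (∏ i ∈ s.support, (N : ℝ) ^ s i) * ∏ i ∈ s.support, ((q i : ℝ) / N) ^ s i =
        ∏ i ∈ s.support, (q i : ℝ) ^ s i := by
      rw [← Finset.prod_mul_distrib]
      refine Finset.prod_congr rfl fun i _ => ?_
      rw [← mul_pow, mul_div_cancel₀ _ hN']
    rw [← Finset.mul_prod_erase _ _ hs, h2]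
    push_cast
    rw [← h1, ← h3]
    ring
  choose! z hz using key
  refine ⟨∑ s ∈ Q.support, z s, ?_⟩
  rw [aeval_def, eval₂_eq, Finset.mul_sum]
  push_cast
  refine Finset.sum_congr rfl fun s hs => ?_
  rw [← hz s hs]
  simp

theorem hasStrictFDerivAt_aeval [Fintype ι] (Q : MvPolynomial ι ℚ) (x : ι → ℝ) :
    HasStrictFDerivAt (fun y : ι → ℝ => aeval y Q)
      (∑ i, aeval x (pderiv i Q) •
        ContinuousLinearMap.proj (R := ℝ) (φ := fun _ : ι => ℝ) i) x := by
  classical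
  induction Q using MvPolynomial.induction_on with
  | C a => simpa using hasStrictFDerivAt_const _ _
  | add p q hp hq =>
    convert! hp.add hq using 1
    · ext y; simp
    · simp [add_smul, Finset.sum_add_distrib]
  | mul_X p i hp =>
    have h := hp.mul (ContinuousLinearMap.proj (R := ℝ) (φ := fun _ : ι => ℝ) i).hasStrictFDerivAt
    convert! h using 1
    · ext y; simp
    · simp only [Derivation.leibniz, pderiv_X, map_add, smul_eq_mul, map_mul, aeval_X, add_smul,
        Finset.sum_add_distrib, Finset.smul_sum, mul_smul, ContinuousLinearMap.proj_apply]
      congr 1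
      rw [Finset.sum_eq_single i]
      · simp
      · intro j _ hj; simp [hj.symm]
      · simp

theorem exists_pderiv_ne_zero {Q : MvPolynomial ι ℚ} (hQ : Q.totalDegree ≠ 0) :
    ∃ i, pderiv i Q ≠ 0 := by
  classical
  by_contra! h
  apply hQ
  rw [totalDegree_eq_zero_iff]
  intro s hs i
  by_contra hi
  have h1 := coeff_pderiv (i := i) Q (s - Finsupp.single i 1)
  have h2 : s - Finsupp.single i 1 + Finsupp.single i 1 = s :=
    tsub_add_cancel_of_le (by simpa [Nat.one_le_iff_ne_zero] using hi)
  rw [h i, h2, coeff_zero] at h1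
  have h3 : Q.coeff s ≠ 0 := mem_support_iff.1 hs
  have h4 : ((((s - Finsupp.single i 1 : ι →₀ ℕ) i : ℕ) : ℚ) + 1) ≠ 0 := by positivity
  exact (mul_ne_zero h3 h4) h1.symm

theorem totalDegree_pderiv_lt {Q : MvPolynomial ι ℚ} {i : ι} (h : pderiv i Q ≠ 0) :
    (pderiv i Q).totalDegree < Q.totalDegree := by
  classical
  have key : ∀ s ∈ (pderiv i Q).support, (s.sum fun _ e => e) + 1 ≤ Q.totalDegree := by
    intro s hs
    rw [mem_support_iff, coeff_pderiv] at hs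
    have := le_totalDegree (mem_support_iff.2 (left_ne_zero_of_mul hs))
    rwa [Finsupp.sum_add_index' (by simp) (by simp), Finsupp.sum_single_index rfl] at this
  obtain ⟨s, hs⟩ := support_nonempty.2 h
  rw [totalDegree, Finset.sup_lt_iff (lt_of_lt_of_le (by simp) (key s hs))]
  exact fun s hs => key s hs

/-- A zero of a nonzero polynomial is a regular zero of a nonzero polynomial of no larger degree:
keep passing to a nonzero partial derivative as long as all partial derivatives vanish at the
point; this lowers the degree, and a nonzero constant has no zeros. -/
theorem exists_aeval_eq_zero_pderiv_ne_zero {P : MvPolynomial ι ℚ} (hP : P ≠ 0) {x : ι → ℝ}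
    (hx : aeval x P = 0) :
    ∃ Q : MvPolynomial ι ℚ, Q.totalDegree ≤ P.totalDegree ∧ aeval x Q = 0 ∧
      ∃ i, aeval x (pderiv i Q) ≠ 0 := by
  induction hn : P.totalDegree using Nat.strong_induction_on generalizing P with
  | _ n ih =>
    have h0 : P.totalDegree ≠ 0 := by
      intro h0
      rw [totalDegree_eq_zero_iff_eq_C] at h0
      rw [h0, aeval_C] at hx
      apply hP
      rw [h0, (by simpa using hx : coeff 0 P = 0), C_0]
    obtain ⟨i, hi⟩ := exists_pderiv_ne_zero h0
    by_cases hxi : aeval x (pderiv i P) = 0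
    · obtain ⟨Q, hQ, h⟩ := ih _ (hn ▸ totalDegree_pderiv_lt hi) hi hxi rfl
      exact ⟨Q, hQ.trans (hn ▸ (totalDegree_pderiv_lt hi).le), h⟩
    · exact ⟨P, hn.le, hx, i, hxi⟩

end MvPolynomial

/-! ### Perturbed grids -/

/-- A rule for perturbing the grids `N⁻¹ ℤⁿ`, for all `N` at once: the grid point `p` is moved by
`shift p` units of length `1 / (scale * N ^ d)` and becomes the lower corner of a cube with sides
of one such unit. Only `N ≥ threshold` is ever used. The bound on `shift` keeps the cube within
distance `1 / (2 * N)` of `p` when `d ≥ 1`. -/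
structure PerturbedGrid (n : ℕ) where
  shift : (Fin n → ℝ) → Fin n → ℕ
  scale : ℕ
  threshold : ℕ
  two_mul_shift_add_one_le : ∀ p i, 2 * (shift p i + 1) ≤ scale

namespace PerturbedGrid

variable {n : ℕ} (G : PerturbedGrid n) (d N : ℕ)

/-- The shift at the grid point `q / N`. -/
noncomputable def shiftAt (q : Fin n → ℕ) : Fin n → ℕ := G.shift fun i => (q i : ℝ) / N

/-- The cube of side `1 / (scale * N ^ d)` attached to the grid point `q / N`. -/
def box (q : Fin n → ℕ) : Set (Fin n → ℝ) :=
  Set.Icc (fun i => (q i : ℝ) / N + (G.shiftAt N q i : ℝ) / (G.scale * (N : ℝ) ^ d))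
    (fun i => (q i : ℝ) / N + ((G.shiftAt N q i : ℝ) + 1) / (G.scale * (N : ℝ) ^ d))

/-- The union of the cubes attached to the grid points in `[0, 1)ⁿ`. -/
def cells : Set (Fin n → ℝ) := ⋃ q : Fin n → Fin N, G.box d N fun i => q i

theorem isClosed_cells : IsClosed (G.cells d N) :=
  isClosed_iUnion_of_finite fun _ => isClosed_Icc

variable [NeZero n] in
theorem scale_pos : 0 < G.scale := by
  have := G.two_mul_shift_add_one_le 0 0
  omega

end PerturbedGrid

open MvPolynomial in
/-- Near a tuple of distinct points at which some partial derivative of `Q` does not vanish, the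
cubes of a suitable perturbed grid contain no zero of `Q`. Only the grid points near one point of
the tuple are moved, along one coordinate axis. At the grid points before the move, the value of `Q`
is an integer multiple of `1 / (c * N ^ d)`; if this multiple is nonzero, it dominates the change
of `Q` due to the perturbation, and if it is zero, the change of `Q` is itself nonzero. -/
theorem PerturbedGrid.exists_forall_aeval_ne_zero {m n d : ℕ} (hd : 1 ≤ d)
    {Q : MvPolynomial (Fin m × Fin n) ℚ} (hQ : Q.totalDegree ≤ d) {x₀ : Fin m → Fin n → ℝ}
    (hinj : Function.Injective x₀)
    (hder : ∃ s, aeval (fun s => x₀ s.1 s.2) (pderiv s Q) ≠ 0) :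
    ∃ G : PerturbedGrid n, ∃ U ∈ 𝓝 x₀, ∀ N, G.threshold ≤ N → ∀ x ∈ U,
      (∀ j, x j ∈ G.cells d N) → aeval (fun s => x s.1 s.2) Q ≠ 0 := by
  classical
  obtain ⟨⟨j₀, l⟩, ha⟩ := hder
  set y₀ : Fin m × Fin n → ℝ := fun s => x₀ s.1 s.2 with hy₀
  set a := aeval y₀ (pderiv (j₀, l) Q) with ha_def
  have hF := hasStrictFDerivAt_aeval Q y₀
  set F' := ∑ i, aeval y₀ (pderiv i Q) •
    ContinuousLinearMap.proj (R := ℝ) (φ := fun _ : Fin m × Fin n => ℝ) i with hF'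
  have hF'e : F' (Pi.single (j₀, l) 1) = a := by
    rw [hF', _root_.sum_apply, Finset.sum_eq_single (j₀, l)]
    · simp [ha_def]
    · intro s _ hs; simp [hs]
    · simp
  have ha' : 0 < |a| := abs_pos.2 ha
  obtain ⟨s, hs, happ⟩ := hF.approximates_deriv_on_nhds (c := (‖a‖₊ / 4))
    (Or.inr (div_pos (nnnorm_pos.2 ha) four_pos))
  have happ' : ∀ x ∈ s, ∀ y ∈ s, |aeval x Q - aeval y Q - F' (x - y)| ≤ |a| / 4 * ‖x - y‖ := by
    intro x hx y hy
    simpa using happ x hx y hy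
  obtain ⟨ρ₁, hρ₁, hball⟩ := Metric.mem_nhds_iff.1 hs
  obtain ⟨ρ, hρ, hρρ₁, hsep⟩ : ∃ ρ : ℝ, 0 < ρ ∧ ρ ≤ ρ₁ ∧
      ∀ j, j ≠ j₀ → 2 * ρ ≤ dist (x₀ j) (x₀ j₀) := by
    have h1 : ∀ᶠ ρ : ℝ in 𝓝[>] 0, ∀ j, j ≠ j₀ → 2 * ρ ≤ dist (x₀ j) (x₀ j₀) := by
      refine eventually_all.2 fun j => ?_
      by_cases hj : j = j₀
      · simp [hj]
      have : 0 < dist (x₀ j) (x₀ j₀) / 2 := half_pos (dist_pos.2 (hinj.ne hj))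
      filter_upwards [Ioc_mem_nhdsGT this] with ρ hρ _
      linarith [hρ.2]
    obtain ⟨ρ, h, h'⟩ := (h1.and (Ioc_mem_nhdsGT hρ₁)).exists
    exact ⟨ρ, h'.1, h'.2, h⟩
  obtain ⟨c, hc, hint⟩ := exists_pos_mul_pow_mul_aeval_eq_intCast Q hQ
  -- the shift is large enough for the main term `K * a` to beat all errors
  obtain ⟨K, hK⟩ := exists_nat_gt (2 * ‖F'‖ / |a| + 1)
  have hK' : 2 * ‖F'‖ + |a| < K * |a| := by
    have := mul_lt_mul_of_pos_right hK ha'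
    rwa [add_mul, div_mul_cancel₀ _ ha'.ne', one_mul] at this
  -- the scale makes the change of `Q` smaller than the gap `1 / (c * N ^ d)` between its values
  obtain ⟨W₁, hW₁⟩ := exists_nat_gt (c * ((‖F'‖ + |a| / 4) * (K + 1)))
  obtain ⟨N₀, hN₀⟩ := exists_nat_gt (1 / ρ)
  let G : PerturbedGrid n :=
    { shift := fun p i => if dist p (x₀ j₀) < ρ ∧ i = l then K else 0
      scale := W₁ + 2 * (K + 1)
      threshold := N₀
      two_mul_shift_add_one_le := fun p i => by split_ifs <;> omega }
  refine ⟨G, Metric.ball x₀ (ρ / 2), Metric.ball_mem_nhds _ (half_pos hρ), ?_⟩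
  intro N hN x hxU hx hzero
  have hNρ : 1 / ρ < N := hN₀.trans_le (by exact_mod_cast hN)
  have hN0 : (0 : ℝ) < N := (by positivity : (0 : ℝ) < 1 / ρ).trans hNρ
  have hN1 : (1 : ℝ) ≤ N := by exact_mod_cast (by exact_mod_cast hN0 : 0 < N)
  choose q hq using fun j => Set.mem_iUnion.1 (hx j)
  set D : ℝ := (G.scale : ℝ) * (N : ℝ) ^ d with hD
  have hscale : (G.scale : ℝ) = W₁ + 2 * (K + 1) := by simp [G]
  have hNd : (N : ℝ) ≤ (N : ℝ) ^ d := le_self_pow₀ hN1 (by omega)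
  have hDpos : 0 < D := by rw [hD, hscale]; positivity
  set p : Fin m × Fin n → ℝ := fun s => (q s.1 s.2 : ℝ) / N with hp
  set X : Fin m × Fin n → ℝ := fun s => x s.1 s.2 with hX
  set σ : Fin m × Fin n → ℕ := fun s => G.shiftAt N (fun i => q s.1 i) s.2 with hσ
  have hσK : ∀ s, (σ s : ℝ) ≤ K := by
    intro s
    have : σ s ≤ K := by
      simp only [hσ, G, PerturbedGrid.shiftAt]; split_ifs <;> omega
    exact_mod_cast this
  have hlow : ∀ s, (σ s : ℝ) / D ≤ (X - p) s := fun s => by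
    have := (hq s.1).1 s.2
    simp only [Pi.sub_apply]
    exact le_sub_iff_add_le'.2 this
  have hupp : ∀ s, (X - p) s ≤ ((σ s : ℝ) + 1) / D := fun s => by
    have := (hq s.1).2 s.2
    simp only [Pi.sub_apply]
    exact sub_le_iff_le_add'.2 this
  have hv : ‖X - p‖ ≤ (K + 1) / D := by
    refine (pi_norm_le_iff_of_nonneg (by positivity)).2 fun s => ?_
    rw [Real.norm_of_nonneg (le_trans (by positivity) (hlow s))]
    refine (hupp s).trans ?_
    gcongr
    exact_mod_cast hσK s
  have hvρ : (K + 1) / D < ρ / 2 := by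
    rw [div_lt_iff₀ hDpos, hD, hscale]
    have h1 : 1 < ρ * N := by rwa [div_lt_iff₀' hρ] at hNρ
    have h2 : 1 < ρ * (N : ℝ) ^ d := h1.trans_le (by gcongr)
    have h3 : (K : ℝ) + 1 < (K + 1) * (ρ * (N : ℝ) ^ d) := lt_mul_of_one_lt_right (by positivity) h2
    have h4 : (0 : ℝ) ≤ ρ / 2 * (W₁ * (N : ℝ) ^ d) := by positivity
    linarith
  have hXball : dist X y₀ < ρ / 2 := by
    refine (dist_pi_lt_iff (half_pos hρ)).2 fun s => ?_
    exact (dist_le_pi_dist (x s.1) (x₀ s.1) s.2).trans_lt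
      ((dist_le_pi_dist x x₀ s.1).trans_lt (Metric.mem_ball.1 hxU))
  have hpball : dist p y₀ < ρ := by
    have : dist p X ≤ (K + 1) / D := by rw [dist_comm, dist_eq_norm]; exact hv
    linarith [dist_triangle p X y₀]
  have hpj : ∀ j, dist (fun i => (q j i : ℝ) / N) (x₀ j) < ρ := fun j =>
    (dist_pi_lt_iff hρ).2 fun i => (dist_le_pi_dist p y₀ (j, i)).trans_lt hpball
  have hσ1 : σ (j₀, l) = K := by
    simp only [hσ, G, PerturbedGrid.shiftAt]
    exact if_pos ⟨hpj j₀, trivial⟩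
  have hσ0 : ∀ s, s ≠ (j₀, l) → σ s = 0 := by
    rintro ⟨j, i⟩ hs
    simp only [hσ, G, PerturbedGrid.shiftAt]
    refine if_neg ?_
    rintro ⟨h1, rfl⟩
    have hj : j ≠ j₀ := fun h => hs (by rw [h])
    have := hsep j hj
    have h2 := hpj j
    rw [dist_comm] at h2
    linarith [dist_triangle (x₀ j) (fun i => (q j i : ℝ) / N) (x₀ j₀)]
  -- up to the bounded error `u`, the perturbation is `K` units along one coordinate axis
  set u : Fin m × Fin n → ℝ := D • (X - p) - (K : ℝ) • Pi.single (j₀, l) 1 with hu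
  have hu_norm : ‖u‖ ≤ 1 := by
    refine (pi_norm_le_iff_of_nonneg zero_le_one).2 fun s => ?_
    have h1 := (div_le_iff₀' hDpos).1 (hlow s)
    have h2 := (le_div_iff₀' hDpos).1 (hupp s)
    have h3 : u s = D * (X - p) s - σ s := by
      by_cases hs : s = (j₀, l)
      · subst hs; simp [hu, hσ1]
      · simp [hu, hσ0 s hs, hs]
    rw [h3, Real.norm_of_nonneg (by linarith)]
    linarith
  have hFv : D * F' (X - p) = K * a + F' u := by
    have : D • (X - p) = (K : ℝ) • Pi.single (j₀, l) 1 + u := by rw [hu]; abel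
    rw [← smul_eq_mul, ← map_smul, this, map_add, map_smul, hF'e, smul_eq_mul]
  have hapx := happ' X (hball (Metric.mem_ball.2 (by linarith))) p
    (hball (Metric.mem_ball.2 (by linarith)))
  rw [hzero, zero_sub] at hapx
  have hapx' : |-aeval p Q - F' (X - p)| ≤ |a| / 4 * ((K + 1) / D) := hapx.trans (by gcongr)
  have hpz : aeval p Q = 0 := by
    obtain ⟨z, hz⟩ := hint N (by exact_mod_cast hN0) (fun s => q s.1 s.2)
    have h1 : |aeval p Q| ≤ (‖F'‖ + |a| / 4) * ((K + 1) / D) := by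
      have h2 : |F' (X - p)| ≤ ‖F'‖ * ((K + 1) / D) :=
        (F'.le_opNorm (X - p)).trans (by gcongr)
      have h3 : |aeval p Q| ≤ |-aeval p Q - F' (X - p)| + |F' (X - p)| := by
        have := abs_add_le (-aeval p Q - F' (X - p)) (F' (X - p))
        rwa [sub_add_cancel, abs_neg] at this
      linarith
    have h4 : |(z : ℝ)| < 1 := by
      rw [← hz, abs_mul, abs_of_nonneg (by positivity)]
      calc (c : ℝ) * (N : ℝ) ^ d * |aeval p Q|
          ≤ c * (N : ℝ) ^ d * ((‖F'‖ + |a| / 4) * ((K + 1) / D)) := by gcongr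
        _ = c * ((‖F'‖ + |a| / 4) * (K + 1)) / G.scale := by rw [hD]; field_simp
        _ < 1 := by
          rw [hscale, div_lt_one (by positivity)]
          have : (0 : ℝ) ≤ 2 * (K + 1) := by positivity
          linarith
    have h5 : z = 0 := by
      rw [← Int.abs_lt_one_iff]; exact_mod_cast h4
    rw [h5, Int.cast_zero] at hz
    exact (mul_eq_zero.1 hz).resolve_left (by positivity)
  rw [hpz, neg_zero, zero_sub, abs_neg] at hapx'
  have h1 : |D * F' (X - p)| ≤ |a| / 4 * (K + 1) := by
    rw [abs_mul, abs_of_pos hDpos]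
    calc D * |F' (X - p)| ≤ D * (|a| / 4 * ((K + 1) / D)) := by gcongr
      _ = |a| / 4 * (K + 1) := by field_simp
  have h2 : |F' u| ≤ ‖F'‖ := by
    have := F'.le_opNorm u
    exact this.trans (mul_le_of_le_one_right (norm_nonneg _) hu_norm)
  have h3 : (K : ℝ) * |a| ≤ |K * a + F' u| + |F' u| := by
    have := abs_sub (K * a + F' u) (F' u)
    rwa [add_sub_cancel_right, abs_mul, Nat.abs_cast] at this
  rw [hFv] at h1
  linarith [norm_nonneg F']

open MvPolynomial in
/-- Countably many perturbed grids take care of all rational polynomials of degree at most `d`, in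
any number of points. -/
theorem PerturbedGrid.exists_seq {n d : ℕ} (hd : 1 ≤ d) :
    ∃ G : ℕ → PerturbedGrid n, ∀ N : ℕ → ℕ, (∀ k, (G k).threshold ≤ N k) →
      ∀ (m : ℕ) (P : MvPolynomial (Fin m × Fin n) ℚ), P ≠ 0 → P.totalDegree ≤ d →
      ∀ x : Fin m → Fin n → ℝ, Function.Injective x → (∀ j k, x j ∈ (G k).cells d (N k)) →
        aeval (fun s => x s.1 s.2) P ≠ 0 := by
  classical
  let S : (Q : Σ m : ℕ, MvPolynomial (Fin m × Fin n) ℚ) → PerturbedGrid n →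
      Set (Fin Q.1 → Fin n → ℝ) :=
    fun Q G => {x | ∀ N, G.threshold ≤ N → (∀ j, x j ∈ G.cells d N) →
      aeval (fun s => x s.1 s.2) Q.2 ≠ 0}
  have hcover : ∀ Q : Σ m : ℕ, MvPolynomial (Fin m × Fin n) ℚ,
      ∃ T : Set (PerturbedGrid n), T.Countable ∧ (Q.2.totalDegree ≤ d →
        ∀ x : Fin Q.1 → Fin n → ℝ, Function.Injective x →
          (∃ s, aeval (fun s => x s.1 s.2) (pderiv s Q.2) ≠ 0) → ∃ G ∈ T, x ∈ S Q G) := by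
    rintro ⟨m, Q⟩
    by_cases hQ : Q.totalDegree ≤ d
    swap
    · exact ⟨∅, Set.countable_empty, fun h => absurd h hQ⟩
    let Z : Set (Fin m → Fin n → ℝ) := {x | Function.Injective x ∧
      ∃ s, aeval (fun s => x s.1 s.2) (pderiv s Q) ≠ 0}
    have hloc : ∀ x : Fin m → Fin n → ℝ, ∃ G, x ∈ Z → S ⟨m, Q⟩ G ∈ 𝓝 x := by
      intro x
      by_cases hx : x ∈ Z
      · obtain ⟨G, U, hU, h⟩ :=
          PerturbedGrid.exists_forall_aeval_ne_zero hd hQ hx.1 hx.2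
        exact ⟨G, fun _ => mem_of_superset hU fun y hy N hN => h N hN y hy⟩
      · exact ⟨⟨0, 2, 0, by simp⟩, fun h => absurd h hx⟩
    choose g hg using hloc
    obtain ⟨t, htZ, htc, ht⟩ := TopologicalSpace.countable_cover_nhdsWithin
      (f := fun x => S ⟨m, Q⟩ (g x)) (s := Z) fun x hx => mem_nhdsWithin_of_mem_nhds (hg x hx)
    refine ⟨g '' t, htc.image g, fun _ x h1 h2 => ?_⟩
    obtain ⟨y, hy, hxy⟩ := Set.mem_iUnion₂.1 (ht ⟨h1, h2⟩)
    exact ⟨g y, ⟨y, hy, rfl⟩, hxy⟩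
  choose T hTc hT using hcover
  have : Countable (Σ m : ℕ, MvPolynomial (Fin m × Fin n) ℚ) := by
    have : ∀ m : ℕ, Countable (MvPolynomial (Fin m × Fin n) ℚ) := fun m => by
      rw [← Cardinal.mk_le_aleph0_iff]
      exact MvPolynomial.cardinalMk_le_max.trans
        (by simpa using mod_cast Cardinal.natCast_le_aleph0 (n := m * n))
    infer_instance
  obtain ⟨G, hG⟩ := (((Set.countable_iUnion hTc).insert
    (⟨0, 2, 0, by simp⟩ : PerturbedGrid n))).exists_eq_range (Set.insert_nonempty _ _)
  refine ⟨G, fun N hN m P hP hPd x hinj hx hzero => ?_⟩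
  obtain ⟨Q, hQ, hQ0, hQ'⟩ := exists_aeval_eq_zero_pderiv_ne_zero hP hzero
  obtain ⟨H, hH, hxH⟩ := hT ⟨m, Q⟩ (hQ.trans hPd) x hinj hQ'
  obtain ⟨k, rfl⟩ : H ∈ Set.range G := by
    rw [← hG]; exact Or.inr (Set.mem_iUnion.2 ⟨_, hH⟩)
  exact hxH (N k) (hN k) (fun j => hx j k) hQ0

/-! ### The Cantor set of a sequence of perturbed grids -/

namespace PerturbedGrid

variable {n : ℕ} (G : ℕ → PerturbedGrid n) (d : ℕ)

/-- The inverse side length of the cubes of generation `k`. A cube of generation `k` meets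
`branch k` points, in each coordinate direction, of the grid used for generation `k + 1`; the
number `branch k` is chosen so large that earlier generations do not affect the dimension. -/
noncomputable def denom : ℕ → ℕ
  | 0 => 1
  | k + 1 => (G k).scale *
      ((((G k).scale * denom k ^ d) ^ k * ((G k).threshold + k + 2)) * denom k) ^ d

/-- The number of subdivisions of a cube of generation `k` in each coordinate direction. -/
noncomputable def branch (k : ℕ) : ℕ :=
  ((G k).scale * denom G d k ^ d) ^ k * ((G k).threshold + k + 2)

/-- The inverse mesh of the unperturbed grid from which generation `k + 1` is obtained. -/
noncomputable def mesh (k : ℕ) : ℕ := branch G d k * denom G d k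

/-- The number of cubes of generation `k` in each coordinate direction. -/
noncomputable def total (k : ℕ) : ℕ := ∏ j ∈ Finset.range k, branch G d j

/-- The mixed-radix digits of `t`, truncated to generation `k`, as one integer per coordinate. -/
noncomputable def code (k : ℕ) (t : Fin n → ℝ) : Fin n → ℕ := fun i => ⌊total G d k * t i⌋₊

/-- The lower corner, in units of `1 / denom k`, of the cube of generation `k` coded by `t`. -/
noncomputable def num : ℕ → (Fin n → ℝ) → Fin n → ℕ
  | 0, _ => 0
  | k + 1, t =>
    let q : Fin n → ℕ := fun i => branch G d k * num k t i + code G d (k + 1) t i % branch G d k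
    fun i => (G k).scale * mesh G d k ^ (d - 1) * q i + (G k).shiftAt (mesh G d k) q i

/-- The grid point, in units of `1 / mesh k`, whose cube is the one of generation `k + 1` coded
by `t`. -/
noncomputable def gridIndex (k : ℕ) (t : Fin n → ℝ) : Fin n → ℕ :=
  fun i => branch G d k * num G d k t i + code G d (k + 1) t i % branch G d k

/-- The point coded by `t`: the common point of the cubes of all generations coded by `t`. -/
noncomputable def point (t : Fin n → ℝ) : Fin n → ℝ :=
  fun i => ⨆ k, (num G d k t i : ℝ) / denom G d k

theorem denom_succ (k : ℕ) : denom G d (k + 1) = (G k).scale * mesh G d k ^ d := rfl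

theorem num_succ (k : ℕ) (t : Fin n → ℝ) (i : Fin n) :
    num G d (k + 1) t i = (G k).scale * mesh G d k ^ (d - 1) * gridIndex G d k t i +
      (G k).shiftAt (mesh G d k) (gridIndex G d k t) i := rfl

theorem total_succ (k : ℕ) : total G d (k + 1) = total G d k * branch G d k :=
  Finset.prod_range_succ _ _

theorem code_succ_div (k : ℕ) (hk : 0 < branch G d k) (t : Fin n → ℝ) (i : Fin n) :
    code G d (k + 1) t i / branch G d k = code G d k t i := by
  have : (branch G d k : ℝ) ≠ 0 := by positivity
  rw [code, code, ← Nat.floor_div_natCast, total_succ]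
  congr 1
  push_cast
  field_simp

theorem pow_le_branch (k : ℕ) : ((G k).scale * denom G d k ^ d) ^ k ≤ branch G d k :=
  Nat.le_mul_of_pos_right _ (by omega)

theorem denom_succ' {d : ℕ} (hd : 1 ≤ d) (k : ℕ) :
    denom G d (k + 1) = (G k).scale * mesh G d k ^ (d - 1) * mesh G d k := by
  rw [denom_succ, mul_assoc, ← pow_succ, Nat.sub_add_cancel hd]

theorem abs_sub_mul_total_lt {k : ℕ} {t t' : Fin n → ℝ} (ht : 0 ≤ t) (ht' : 0 ≤ t') (i : Fin n) :
    |t i - t' i| * total G d k < |(code G d k t i : ℝ) - code G d k t' i| + 1 := by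
  have key : ∀ t : Fin n → ℝ, 0 ≤ t → (code G d k t i : ℝ) ≤ total G d k * t i ∧
      total G d k * t i < code G d k t i + 1 := fun t ht =>
    ⟨Nat.floor_le (mul_nonneg (Nat.cast_nonneg _) (ht i)), Nat.lt_floor_add_one _⟩
  have h1 := key t ht
  have h2 := key t' ht'
  rw [← Nat.abs_cast (total G d k), ← abs_mul, abs_lt]
  have h3 := le_abs_self ((code G d k t i : ℝ) - code G d k t' i)
  have h4 := neg_abs_le ((code G d k t i : ℝ) - code G d k t' i)
  constructor <;> nlinarith

section

variable [NeZero n]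

theorem denom_pos (k : ℕ) : 0 < denom G d k := by
  induction k with
  | zero => exact one_pos
  | succ k ih => have := (G k).scale_pos; rw [denom]; positivity

theorem add_two_le_branch (k : ℕ) : (G k).threshold + k + 2 ≤ branch G d k := by
  have := (G k).scale_pos
  have := denom_pos G d k
  exact Nat.le_mul_of_pos_left _ (by positivity)

theorem branch_pos (k : ℕ) : 0 < branch G d k := by
  have := add_two_le_branch G d k; omega

theorem mesh_pos (k : ℕ) : 0 < mesh G d k := Nat.mul_pos (branch_pos G d k) (denom_pos G d k)

theorem branch_le_mesh (k : ℕ) : branch G d k ≤ mesh G d k :=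
  Nat.le_mul_of_pos_right _ (denom_pos G d k)

theorem total_pos (k : ℕ) : 0 < total G d k := Finset.prod_pos fun j _ => branch_pos G d j

theorem two_pow_le_total (k : ℕ) : 2 ^ k ≤ total G d k := by
  induction k with
  | zero => simp [total]
  | succ k ih =>
    rw [total_succ, pow_succ]
    have := add_two_le_branch G d k
    exact Nat.mul_le_mul ih (by omega)

theorem gridIndex_lt_of_num_lt {k : ℕ} {t : Fin n → ℝ} {i : Fin n}
    (h : num G d k t i < denom G d k) : gridIndex G d k t i < mesh G d k := by
  have h1 := Nat.mod_lt (code G d (k + 1) t i) (branch_pos G d k)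
  calc gridIndex G d k t i < branch G d k * num G d k t i + branch G d k :=
        Nat.add_lt_add_left h1 _
    _ = branch G d k * (num G d k t i + 1) := by ring
    _ ≤ mesh G d k := Nat.mul_le_mul_left _ h

variable {d}

theorem two_mul_shiftAt_add_one_le (k : ℕ) (q : Fin n → ℕ) (i : Fin n) :
    2 * ((G k).shiftAt (mesh G d k) q i + 1) ≤ (G k).scale * mesh G d k ^ (d - 1) :=
  ((G k).two_mul_shift_add_one_le _ i).trans
    (Nat.le_mul_of_pos_right _ (pow_pos (mesh_pos G d k) _))

theorem num_lt (hd : 1 ≤ d) (k : ℕ) (t : Fin n → ℝ) (i : Fin n) : num G d k t i < denom G d k := by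
  induction k with
  | zero => exact one_pos
  | succ k ih =>
    have h1 := gridIndex_lt_of_num_lt G d ih
    have h2 := two_mul_shiftAt_add_one_le G (d := d) k (gridIndex G d k t) i
    rw [num_succ, denom_succ' G hd]
    have h3 := Nat.mul_le_mul_left ((G k).scale * mesh G d k ^ (d - 1)) h1
    rw [Nat.succ_eq_add_one, mul_add] at h3
    omega

theorem gridIndex_lt (hd : 1 ≤ d) (k : ℕ) (t : Fin n → ℝ) (i : Fin n) :
    gridIndex G d k t i < mesh G d k :=
  gridIndex_lt_of_num_lt G d (num_lt G hd k t i)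

theorem num_succ_div (hd : 1 ≤ d) (k : ℕ) (t : Fin n → ℝ) (i : Fin n) :
    (num G d (k + 1) t i : ℝ) / denom G d (k + 1) = (gridIndex G d k t i : ℝ) / mesh G d k +
      ((G k).shiftAt (mesh G d k) (gridIndex G d k t) i : ℝ) / denom G d (k + 1) := by
  have h1 : (0 : ℝ) < mesh G d k := by exact_mod_cast mesh_pos G d k
  have h2 : (0 : ℝ) < (G k).scale := by exact_mod_cast (G k).scale_pos
  rw [num_succ, denom_succ' G hd]
  push_cast
  field_simp

/-- The cube stays within half the mesh of the grid point. -/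
theorem shiftAt_add_one_div_le (hd : 1 ≤ d) (k : ℕ) (q : Fin n → ℕ) (i : Fin n) :
    (((G k).shiftAt (mesh G d k) q i : ℝ) + 1) / denom G d (k + 1) ≤ 1 / 2 / mesh G d k := by
  have h1 : (0 : ℝ) < mesh G d k := by exact_mod_cast mesh_pos G d k
  have h2 : (0 : ℝ) < (G k).scale := by exact_mod_cast (G k).scale_pos
  have h3 : (2 : ℝ) * ((G k).shiftAt (mesh G d k) q i + 1) ≤
      (G k).scale * (mesh G d k : ℝ) ^ (d - 1) := by
    exact_mod_cast two_mul_shiftAt_add_one_le G k q i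
  rw [denom_succ' G hd]
  push_cast
  rw [div_le_div_iff₀ (by positivity) h1]
  nlinarith

theorem monotone_num_div (hd : 1 ≤ d) (t : Fin n → ℝ) (i : Fin n) :
    Monotone fun k => (num G d k t i : ℝ) / denom G d k := by
  refine monotone_nat_of_le_succ fun k => ?_
  have h1 : (0 : ℝ) < branch G d k := by exact_mod_cast branch_pos G d k
  have h2 : (0 : ℝ) < denom G d k := by exact_mod_cast denom_pos G d k
  rw [num_succ_div G hd]
  refine le_add_of_le_of_nonneg ?_ (by positivity)
  rw [gridIndex, mesh]
  push_cast
  rw [div_le_div_iff₀ h2 (by positivity)]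
  have : (0 : ℝ) ≤ ((code G d (k + 1) t i % branch G d k : ℕ) : ℝ) := by positivity
  nlinarith

theorem antitone_num_add_one_div (hd : 1 ≤ d) (t : Fin n → ℝ) (i : Fin n) :
    Antitone fun k => ((num G d k t i : ℝ) + 1) / denom G d k := by
  refine antitone_nat_of_succ_le fun k => ?_
  have h1 : (0 : ℝ) < branch G d k := by exact_mod_cast branch_pos G d k
  have h2 : (0 : ℝ) < denom G d k := by exact_mod_cast denom_pos G d k
  have h3 := shiftAt_add_one_div_le G hd k (gridIndex G d k t) i
  have h4 : (0 : ℝ) < mesh G d k := by exact_mod_cast mesh_pos G d k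
  have h5 : ((gridIndex G d k t i : ℝ) + 1) / mesh G d k ≤
      ((num G d k t i : ℝ) + 1) / denom G d k := by
    have h6 : gridIndex G d k t i + 1 ≤ branch G d k * (num G d k t i + 1) := by
      have := Nat.mod_lt (code G d (k + 1) t i) (branch_pos G d k)
      rw [gridIndex, mul_add]; omega
    have h7 : (gridIndex G d k t i : ℝ) + 1 ≤ branch G d k * (num G d k t i + 1) := by
      exact_mod_cast h6
    rw [div_le_div_iff₀ h4 h2, mesh]
    push_cast
    nlinarith
  have h8 : (1 : ℝ) / 2 / mesh G d k ≤ 1 / mesh G d k := by gcongr; norm_num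
  calc ((num G d (k + 1) t i : ℝ) + 1) / denom G d (k + 1)
      = (gridIndex G d k t i : ℝ) / mesh G d k +
        (((G k).shiftAt (mesh G d k) (gridIndex G d k t) i : ℝ) + 1) / denom G d (k + 1) := by
        rw [add_div, num_succ_div G hd, add_div _ (1 : ℝ), add_assoc]
    _ ≤ ((gridIndex G d k t i : ℝ) + 1) / mesh G d k := by
        rw [add_div (gridIndex G d k t i : ℝ)]; linarith
    _ ≤ _ := h5

theorem point_mem_Icc (hd : 1 ≤ d) (t : Fin n → ℝ) (i : Fin n) (k : ℕ) :
    point G d t i ∈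
      Set.Icc ((num G d k t i : ℝ) / denom G d k) (((num G d k t i : ℝ) + 1) / denom G d k) :=
  Set.mem_iInter.1 ((monotone_num_div G hd t i).ciSup_mem_iInter_Icc_of_antitone
    (antitone_num_add_one_div G hd t i) fun k => by beta_reduce; gcongr; simp) k

theorem point_mem_cells (hd : 1 ≤ d) (t : Fin n → ℝ) (k : ℕ) :
    point G d t ∈ (G k).cells d (mesh G d k) := by
  refine Set.mem_iUnion.2 ⟨fun i => ⟨gridIndex G d k t i, gridIndex_lt G hd k t i⟩, ?_, ?_⟩ <;>
  intro i
  · have h := (point_mem_Icc G hd t i (k + 1)).1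
    rw [num_succ_div G hd, denom_succ] at h
    push_cast at h
    exact h
  · have h := (point_mem_Icc G hd t i (k + 1)).2
    rw [add_div, num_succ_div G hd, add_assoc, ← add_div, denom_succ] at h
    push_cast at h
    exact h

theorem num_congr {k : ℕ} {t t' : Fin n → ℝ} (h : code G d k t = code G d k t') :
    num G d k t = num G d k t' := by
  induction k with
  | zero => rfl
  | succ k ih =>
    have h1 : code G d k t = code G d k t' := by
      ext i
      rw [← code_succ_div G d k (branch_pos G d k), h, code_succ_div G d k (branch_pos G d k)]
    rw [num, num, ih h1, h]

/-! ### Distances between coded points -/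

/-- A gap of `j` grid steps between two grid indices persists, up to half a step, in the points. -/
theorem abs_gridIndex_sub_le (hd : 1 ≤ d) (k : ℕ) (t t' : Fin n → ℝ) (i : Fin n) :
    |(gridIndex G d k t i : ℝ) - gridIndex G d k t' i| ≤
      mesh G d k * dist (point G d t) (point G d t') + 1 / 2 := by
  have h0 : (0 : ℝ) < mesh G d k := by exact_mod_cast mesh_pos G d k
  have key : ∀ t, (gridIndex G d k t i : ℝ) ≤ mesh G d k * point G d t i ∧
      mesh G d k * point G d t i ≤ gridIndex G d k t i + 1 / 2 := by
    intro t
    obtain ⟨h1, h2⟩ := point_mem_Icc G hd t i (k + 1)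
    have h3 := shiftAt_add_one_div_le G hd k (gridIndex G d k t) i
    rw [num_succ_div G hd] at h1
    rw [add_div, num_succ_div G hd, add_assoc, ← add_div] at h2
    have h4 : (0 : ℝ) ≤ ((G k).shiftAt (mesh G d k) (gridIndex G d k t) i : ℝ) /
      denom G d (k + 1) := by positivity
    have h5 : (gridIndex G d k t i : ℝ) / mesh G d k ≤ point G d t i := by linarith
    have h6 : point G d t i ≤ ((gridIndex G d k t i : ℝ) + 1 / 2) / mesh G d k := by
      rw [add_div]; linarith
    exact ⟨(div_le_iff₀' h0).1 h5, (le_div_iff₀' h0).1 h6⟩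
  have h1 : |point G d t i - point G d t' i| ≤ dist (point G d t) (point G d t') :=
    dist_le_pi_dist (point G d t) (point G d t') i
  have h2 : mesh G d k * |point G d t i - point G d t' i| ≤
      mesh G d k * dist (point G d t) (point G d t') := by gcongr
  rw [← abs_of_pos h0, ← abs_mul, abs_of_pos h0] at h2
  have h3 := abs_le.1 h2
  have h4 := key t
  have h5 := key t'
  rw [abs_le]
  constructor <;> linarith

/-- If `k` is the last generation at which the codes of `t` and `t'` agree, then `t` and `t'` are
at most `1 / total k` apart, and the coded points are at least comparably far apart, after
rescaling the cube of generation `k` to the corresponding cube of codes. -/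
theorem exists_dist_le (hd : 1 ≤ d) {t t' : Fin n → ℝ}
    (ht : t ∈ Set.univ.pi fun _ => Set.Ico (0 : ℝ) 1)
    (ht' : t' ∈ Set.univ.pi fun _ => Set.Ico (0 : ℝ) 1) (hne : t ≠ t') :
    ∃ k, dist t t' ≤ 1 / total G d k ∧
      dist t t' ≤ 4 * (denom G d k / total G d k) * dist (point G d t) (point G d t') := by
  classical
  have ht0 : 0 ≤ t := fun i => (ht i trivial).1
  have ht0' : 0 ≤ t' := fun i => (ht' i trivial).1
  have hT : ∀ k, (0 : ℝ) < total G d k := fun k => by exact_mod_cast total_pos G d k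
  have hclose : ∀ k, code G d k t = code G d k t' → dist t t' ≤ 1 / total G d k := by
    intro k hk
    refine (dist_pi_le_iff (one_div_pos.2 (hT k)).le).2 fun i => ?_
    have := abs_sub_mul_total_lt G d (k := k) ht0 ht0' i
    rw [hk, sub_self, abs_zero, zero_add] at this
    rw [Real.dist_eq, le_div_iff₀ (hT k)]
    exact this.le
  have hex : ∃ k, code G d k t ≠ code G d k t' := by
    by_contra! h
    obtain ⟨k, hk⟩ := exists_nat_gt (1 / dist t t')
    have hpos := dist_pos.2 hne
    have h1 := hclose k (h k)
    have h2 : (k : ℝ) ≤ total G d k := by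
      exact_mod_cast Nat.lt_two_pow_self.le.trans (two_pow_le_total G d k)
    rw [div_lt_iff₀ hpos] at hk
    rw [le_div_iff₀ (hT k)] at h1
    nlinarith
  -- the codes of generation `0` are all zero, since `t` and `t'` lie in `[0, 1)ⁿ`
  obtain ⟨k, hk⟩ : ∃ k, Nat.find hex = k + 1 := by
    refine Nat.exists_eq_succ_of_ne_zero fun h => ?_
    have h1 := Nat.find_spec hex
    rw [h] at h1
    apply h1
    ext i
    simp only [code, total, Finset.range_zero, Finset.prod_empty, Nat.cast_one, one_mul]
    rw [Nat.floor_eq_zero.2 (ht i trivial).2, Nat.floor_eq_zero.2 (ht' i trivial).2]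
  have hsame : code G d k t = code G d k t' := by
    by_contra h
    exact Nat.find_min hex (by omega) h
  have hdiff : code G d (k + 1) t ≠ code G d (k + 1) t' := by
    rw [← hk]; exact Nat.find_spec hex
  have hnum := num_congr G hsame
  have hcode : ∀ i, (code G d (k + 1) t i : ℝ) - code G d (k + 1) t' i =
      (gridIndex G d k t i : ℝ) - gridIndex G d k t' i := by
    intro i
    have h1 := Nat.div_add_mod (code G d (k + 1) t i) (branch G d k)
    have h2 := Nat.div_add_mod (code G d (k + 1) t' i) (branch G d k)
    rw [code_succ_div G d k (branch_pos G d k)] at h1 h2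
    rw [← hsame] at h2
    rw [gridIndex, gridIndex, ← hnum, Nat.cast_add, Nat.cast_add, add_sub_add_left_eq_sub]
    rw [← Nat.cast_inj (R := ℝ), Nat.cast_add] at h1 h2
    linarith
  have hM : (0 : ℝ) < branch G d k := by exact_mod_cast branch_pos G d k
  have hD : (0 : ℝ) < denom G d k := by exact_mod_cast denom_pos G d k
  -- some grid index differs, so the points are at least half a mesh apart
  have hfar : 1 / 2 ≤ mesh G d k * dist (point G d t) (point G d t') := by
    obtain ⟨i, hi⟩ := Function.ne_iff.1 hdiff
    have h1 : (1 : ℝ) ≤ |(code G d (k + 1) t i : ℝ) - code G d (k + 1) t' i| := by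
      have : (1 : ℤ) ≤ |(code G d (k + 1) t i : ℤ) - code G d (k + 1) t' i| :=
        Int.one_le_abs (sub_ne_zero.2 (by exact_mod_cast hi))
      exact_mod_cast this
    rw [hcode] at h1
    linarith [abs_gridIndex_sub_le G hd k t t' i]
  refine ⟨k, hclose k hsame, ?_⟩
  refine (dist_pi_le_iff (by positivity)).2 fun i => ?_
  have h1 := abs_sub_mul_total_lt G d (k := k + 1) ht0 ht0' i
  rw [hcode] at h1
  have h2 := abs_gridIndex_sub_le G hd k t t' i
  have h3 : |t i - t' i| * total G d (k + 1) ≤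
      4 * (mesh G d k * dist (point G d t) (point G d t')) := by linarith
  rw [total_succ, mesh] at h3
  push_cast at h3
  rw [Real.dist_eq]
  have h4 : |t i - t' i| * total G d k ≤ 4 * (denom G d k * dist (point G d t) (point G d t')) := by
    refine le_of_mul_le_mul_right ?_ hM
    linarith
  calc |t i - t' i| = |t i - t' i| * total G d k / total G d k := by
        rw [mul_div_cancel_right₀ _ (hT k).ne']
    _ ≤ 4 * (denom G d k * dist (point G d t) (point G d t')) / total G d k := by
        gcongr
    _ = _ := by ring

/-! ### Hölder continuity of the decoding map and the lower bound for the dimension -/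

theorem eventually_denom_rpow_le_total {r : ℝ} (hdr : d * r < 1) :
    ∀ᶠ k in atTop, (denom G d k : ℝ) ^ r ≤ total G d k := by
  obtain ⟨k₀, hk₀⟩ := exists_nat_gt (r / (1 - d * r))
  filter_upwards [eventually_ge_atTop (k₀ + 1)] with k' hk'
  obtain ⟨k, rfl⟩ : ∃ k, k' = k + 1 := Nat.exists_eq_succ_of_ne_zero (by omega)
  have hk : r ≤ k * (1 - d * r) := by
    rw [div_lt_iff₀ (by linarith)] at hk₀
    have : (k₀ : ℝ) ≤ k := by exact_mod_cast (by omega : k₀ ≤ k)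
    nlinarith
  set Y : ℕ := (G k).scale * denom G d k ^ d with hY
  have hY1 : (1 : ℝ) ≤ Y := by
    have := (G k).scale_pos
    have := denom_pos G d k
    exact_mod_cast (by positivity : 0 < Y)
  have hM : (0 : ℝ) < branch G d k := by exact_mod_cast branch_pos G d k
  have hYM : (Y : ℝ) ^ (k : ℝ) ≤ branch G d k := by
    rw [Real.rpow_natCast]; exact_mod_cast pow_le_branch G d k
  have h1 : (denom G d (k + 1) : ℝ) = Y * (branch G d k : ℝ) ^ (d : ℝ) := by
    rw [denom_succ, hY, mesh, Real.rpow_natCast]; push_cast; ring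
  have h2 : (Y : ℝ) ^ r ≤ (branch G d k : ℝ) ^ (1 - d * r) :=
    calc (Y : ℝ) ^ r ≤ (Y : ℝ) ^ (k * (1 - d * r)) := Real.rpow_le_rpow_of_exponent_le hY1 hk
      _ = ((Y : ℝ) ^ (k : ℝ)) ^ (1 - d * r) := Real.rpow_mul (by positivity) _ _
      _ ≤ _ := Real.rpow_le_rpow (by positivity) hYM (by linarith)
  rw [h1, Real.mul_rpow (by positivity) (by positivity), ← Real.rpow_mul hM.le]
  calc (Y : ℝ) ^ r * (branch G d k : ℝ) ^ (d * r)
      ≤ (branch G d k : ℝ) ^ (1 - d * r) * (branch G d k : ℝ) ^ (d * r) := by gcongr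
    _ = branch G d k := by rw [← Real.rpow_add hM, sub_add_cancel, Real.rpow_one]
    _ ≤ total G d (k + 1) := by
      rw [total_succ]
      exact_mod_cast Nat.le_mul_of_pos_left _ (total_pos G d k)

theorem exists_denom_rpow_le_mul_total {r : ℝ} (hdr : d * r < 1) :
    ∃ C : ℝ, 0 ≤ C ∧ ∀ k, (denom G d k : ℝ) ^ r ≤ C * total G d k := by
  obtain ⟨k₀, hk₀⟩ := eventually_atTop.1 (eventually_denom_rpow_le_total G hdr)
  have hnn : ∀ j, (0 : ℝ) ≤ (denom G d j : ℝ) ^ r := fun j => by positivity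
  have hC : 0 ≤ ∑ j ∈ Finset.range k₀, (denom G d j : ℝ) ^ r := Finset.sum_nonneg fun j _ => hnn j
  refine ⟨1 + ∑ j ∈ Finset.range k₀, (denom G d j : ℝ) ^ r, by positivity, fun k => ?_⟩
  have hT : (1 : ℝ) ≤ total G d k := by exact_mod_cast total_pos G d k
  rcases le_or_gt k₀ k with hk | hk
  · have := hk₀ k hk
    nlinarith
  · have := Finset.single_le_sum (fun j _ => hnn j) (Finset.mem_range.2 hk)
    nlinarith

/-- The inverse of the coding is Hölder continuous with every exponent `r < 1 / d`. -/
theorem exists_dist_le_mul_rpow (hd : 1 ≤ d) {r : ℝ} (hr : 0 < r) (hdr : d * r < 1) :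
    ∃ C : NNReal, ∀ t ∈ Set.univ.pi fun _ => Set.Ico (0 : ℝ) 1,
      ∀ t' ∈ Set.univ.pi fun _ => Set.Ico (0 : ℝ) 1,
      dist t t' ≤ C * dist (point G d t) (point G d t') ^ r := by
  obtain ⟨C, hC, hCk⟩ := exists_denom_rpow_le_mul_total G hdr
  have hr1 : r < 1 := by
    have : (1 : ℝ) ≤ d := by exact_mod_cast hd
    nlinarith
  refine ⟨NNReal.mk (4 ^ r * C) (by positivity), fun t ht t' ht' => ?_⟩
  rw [NNReal.coe_mk]
  rcases eq_or_ne t t' with rfl | hne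
  · rw [dist_self]; positivity
  obtain ⟨k, h1, h2⟩ := exists_dist_le G hd ht ht' hne
  have hpos := dist_pos.2 hne
  set δ := dist (point G d t) (point G d t')
  have hT : (0 : ℝ) < total G d k := by exact_mod_cast total_pos G d k
  calc dist t t' = dist t t' ^ (1 - r) * dist t t' ^ r := by
        rw [← Real.rpow_add hpos, sub_add_cancel, Real.rpow_one]
    _ ≤ (1 / total G d k) ^ (1 - r) * (4 * (denom G d k / total G d k) * δ) ^ r := by gcongr
    _ = 4 ^ r * ((denom G d k : ℝ) ^ r * (1 / total G d k)) * δ ^ r := by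
        rw [Real.mul_rpow (by positivity) dist_nonneg, Real.mul_rpow (by norm_num) (by positivity),
          div_eq_mul_one_div (denom G d k : ℝ), Real.mul_rpow (by positivity) (by positivity)]
        have : (1 / (total G d k : ℝ)) ^ (1 - r) * (1 / (total G d k : ℝ)) ^ r =
            1 / total G d k := by
          rw [← Real.rpow_add (by positivity), sub_add_cancel, Real.rpow_one]
        linear_combination (4 ^ r * (denom G d k : ℝ) ^ r * δ ^ r) * this
    _ ≤ 4 ^ r * C * δ ^ r := by
        gcongr
        rw [mul_one_div, div_le_iff₀ hT]
        exact hCk k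

theorem le_dimH_image_point (hd : 1 ≤ d) :
    (n : ℝ≥0∞) / d ≤ dimH (point G d '' Set.univ.pi fun _ => Set.Ico (0 : ℝ) 1) := by
  set S : Set (Fin n → ℝ) := Set.univ.pi fun _ => Set.Ico (0 : ℝ) 1 with hS
  have hn0 : (0 : NNReal) < n := by exact_mod_cast Nat.pos_of_neZero n
  have hd0 : (0 : NNReal) < d := by exact_mod_cast hd
  have hdimS : dimH S = n := by
    have h := Real.dimH_of_mem_nhds (s := S) (x := fun _ : Fin n => (1 / 2 : ℝ))
      (set_pi_mem_nhds Set.finite_univ fun i _ => Ico_mem_nhds (by norm_num) (by norm_num))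
    simpa using h
  refine ENNReal.le_of_forall_nnreal_lt fun s hs => ?_
  rcases eq_or_ne s 0 with rfl | hs0
  · simp
  set r : NNReal := s / n with hr
  have hr0 : 0 < r := div_pos (pos_iff_ne_zero.2 hs0) hn0
  have hdr : (d : ℝ) * r < 1 := by
    have h1 : s < n / d := by
      rw [← ENNReal.coe_lt_coe, ENNReal.coe_div hd0.ne']; simpa using hs
    have h2 : (d : NNReal) * r < 1 := by
      rw [hr, ← mul_div_assoc, div_lt_one hn0, mul_comm]
      exact (lt_div_iff₀ hd0).1 h1
    exact_mod_cast h2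
  obtain ⟨C, hC⟩ := exists_dist_le_mul_rpow G hd (r := r) hr0 hdr
  have hinj : Set.InjOn (point G d) S := by
    intro t ht t' ht' h
    have h1 := hC t ht t' ht'
    rw [h, dist_self, Real.zero_rpow (by exact_mod_cast hr0.ne'), mul_zero] at h1
    exact dist_le_zero.1 h1
  have hhol : HolderOnWith C r (Function.invFunOn (point G d) S) (point G d '' S) := by
    rintro _ ⟨t, ht, rfl⟩ _ ⟨t', ht', rfl⟩
    rw [hinj.leftInvOn_invFunOn ht, hinj.leftInvOn_invFunOn ht', edist_nndist, edist_nndist,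
      ← ENNReal.coe_rpow_of_nonneg _ r.coe_nonneg, ← ENNReal.coe_mul, ENNReal.coe_le_coe]
    exact_mod_cast hC t ht t' ht'
  have h := hhol.dimH_image_le hr0
  rw [hinj.invFunOn_image subset_rfl, hdimS, ENNReal.le_div_iff_mul_le
    (Or.inl (by exact_mod_cast hr0.ne')) (Or.inl ENNReal.coe_ne_top)] at h
  refine le_trans (le_of_eq ?_) h
  have : s = n * r := by rw [hr, mul_div_cancel₀ _ hn0.ne']
  rw [this]
  push_cast
  rfl

end

/-! ### The upper bound for the dimension, and the compact set -/

theorem ediam_box_le {N : ℕ} (hN : 0 < N) (H : PerturbedGrid n) (hH : 0 < H.scale)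
    (q : Fin n → ℕ) : Metric.ediam (H.box d N q) ≤ ((N : ℝ≥0∞) ^ d)⁻¹ := by
  have hN' : (0 : ℝ) < N := by exact_mod_cast hN
  refine Metric.ediam_le fun x hx y hy => edist_pi_le_iff.2 fun i => ?_
  have h1 : |x i - y i| ≤ ((N : ℝ) ^ d)⁻¹ := by
    have h2 := hx.1 i
    have h3 := hx.2 i
    have h4 := hy.1 i
    have h5 := hy.2 i
    simp only [add_div] at h2 h3 h4 h5
    have h6 : (1 : ℝ) / (H.scale * (N : ℝ) ^ d) ≤ ((N : ℝ) ^ d)⁻¹ := by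
      rw [← one_div]
      refine one_div_le_one_div_of_le (by positivity) (le_mul_of_one_le_left (by positivity) ?_)
      exact_mod_cast hH
    rw [abs_le]
    constructor <;> linarith
  rw [edist_dist, Real.dist_eq]
  refine (ENNReal.ofReal_le_ofReal h1).trans (le_of_eq ?_)
  rw [ENNReal.ofReal_inv_of_pos (by positivity), ENNReal.ofReal_pow hN'.le, ENNReal.ofReal_natCast]

/-- A set covered by `N ^ n` cubes of side at most `N ^ (-d)`, for arbitrarily large `N`, has
dimension at most `n / d`. -/
theorem dimH_le_of_subset_cells {d : ℕ} (hd : 1 ≤ d) {E : Set (Fin n → ℝ)} {N : ℕ → ℕ}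
    (hN : Tendsto N atTop atTop) (hs : ∀ k, 0 < (G k).scale) (hE : ∀ k, E ⊆ (G k).cells d (N k)) :
    dimH E ≤ (n : ℝ≥0∞) / d := by
  have hd0 : (d : NNReal) ≠ 0 := by exact_mod_cast (by omega : d ≠ 0)
  have hcoe : (((n : NNReal) / d : NNReal) : ℝ≥0∞) = (n : ℝ≥0∞) / d := by
    rw [ENNReal.coe_div hd0]; simp
  rw [← hcoe]
  refine dimH_le_of_hausdorffMeasure_ne_top (ne_top_of_le_ne_top ENNReal.one_ne_top ?_)
  have hlim : Tendsto (fun k => ((N k : ℝ≥0∞) ^ d)⁻¹) atTop (𝓝 0) := by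
    have h1 : Tendsto (fun k => (N k : ℝ≥0∞) ^ d) atTop (𝓝 ∞) := by
      have := ENNReal.tendsto_nat_nhds_top.comp ((tendsto_pow_atTop (by omega : d ≠ 0)).comp hN)
      refine this.congr fun k => ?_
      simp
    simpa using _root_.tendsto_inv_iff.2 h1
  have hpos := hN.eventually_gt_atTop 0
  refine (Measure.hausdorffMeasure_le_liminf_sum (ι := fun k => Fin n → Fin (N k)) _ E
    (fun k => ((N k : ℝ≥0∞) ^ d)⁻¹) hlim (fun k q => (G k).box d (N k) fun i => q i)
    (hpos.mono fun k hk q => ediam_box_le d hk (G k) (hs k) _) (Eventually.of_forall hE)).trans ?_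
  refine liminf_le_of_frequently_le' (hpos.mono fun k hk => ?_).frequently
  calc ∑ q : Fin n → Fin (N k), Metric.ediam ((G k).box d (N k) fun i => q i) ^
        (((n : NNReal) / d : NNReal) : ℝ)
      ≤ ∑ q : Fin n → Fin (N k), (((N k : ℝ≥0∞) ^ d)⁻¹) ^ (((n : NNReal) / d : NNReal) : ℝ) := by
        refine Finset.sum_le_sum fun q _ => ?_
        exact ENNReal.rpow_le_rpow (ediam_box_le d hk (G k) (hs k) _) NNReal.zero_le_coe
    _ = (N k : ℝ≥0∞) ^ n * ((N k : ℝ≥0∞) ^ n)⁻¹ := by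
        have hd' : (d : ℝ) ≠ 0 := by exact_mod_cast (by omega : d ≠ 0)
        have h2 : (((N k : ℝ≥0∞) ^ d)⁻¹) ^ (((n : NNReal) / d : NNReal) : ℝ) =
            ((N k : ℝ≥0∞) ^ n)⁻¹ := by
          rw [ENNReal.inv_rpow, ← ENNReal.rpow_natCast, ← ENNReal.rpow_mul, ← ENNReal.rpow_natCast]
          congr 2
          push_cast
          field_simp
        rw [Finset.sum_const, h2]
        simp
    _ ≤ 1 := ENNReal.mul_inv_le_one _

/-- For every sequence of perturbed grids there is a compact set of dimension `n / d` which, for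
each `k`, lies in the cubes of the `k`-th perturbed grid of some sufficiently fine mesh. -/
theorem exists_isCompact_subset_cells {d : ℕ} (hn : 1 ≤ n) (hd : 1 ≤ d) :
    ∃ (N : ℕ → ℕ) (E : Set (Fin n → ℝ)), (∀ k, (G k).threshold ≤ N k) ∧ IsCompact E ∧
      dimH E = (n : ℝ≥0∞) / d ∧ ∀ k, E ⊆ (G k).cells d (N k) := by
  have : NeZero n := ⟨by omega⟩
  set S : Set (Fin n → ℝ) := Set.univ.pi fun _ => Set.Ico (0 : ℝ) 1
  have hN : ∀ k, (G k).threshold + k + 2 ≤ mesh G d k := fun k =>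
    (add_two_le_branch G d k).trans (branch_le_mesh G d k)
  have hcells : ∀ k, closure (point G d '' S) ⊆ (G k).cells d (mesh G d k) := fun k =>
    closure_minimal (Set.image_subset_iff.2 fun t _ => point_mem_cells G hd t k)
      ((G k).isClosed_cells _ _)
  refine ⟨mesh G d, closure (point G d '' S), fun k => by have := hN k; omega, ?_, ?_, hcells⟩
  · refine (isCompact_Icc (a := (0 : Fin n → ℝ)) (b := 1)).of_isClosed_subset isClosed_closure
      (closure_minimal (Set.image_subset_iff.2 fun t _ => ?_) isClosed_Icc)
    have h := fun i => point_mem_Icc G hd t i 0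
    simp only [num, denom, Pi.zero_apply, Nat.cast_zero, Nat.cast_one, zero_add,
      div_one] at h
    exact ⟨fun i => (h i).1, fun i => (h i).2⟩
  · refine le_antisymm ?_ ((le_dimH_image_point G hd).trans (dimH_mono subset_closure))
    refine dimH_le_of_subset_cells G hd ?_ (fun k => (G k).scale_pos) hcells
    exact tendsto_atTop_mono (fun k => (by have := hN k; omega : k ≤ mesh G d k)) tendsto_id

end PerturbedGrid

theorem theorem2p3 (n : ℕ) (hn : 1 ≤ n) (d : ℕ) (hd : 1 ≤ d)
    {J : Type*} [Countable J] (m : J → ℕ) (hm : ∀ j, 1 ≤ m j)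
    (P : ∀ j, MvPolynomial (Fin (m j) × Fin n) ℚ)
    (hP : ∀ j, P j ≠ 0) (hdeg : ∀ j, (P j).totalDegree ≤ d) :
    ∃ E : Set (EuclideanSpace ℝ (Fin n)),
      IsCompact E ∧ dimH E = (n : ℝ≥0∞) / (d : ℝ≥0∞) ∧
      ∀ (j : J) (x : Fin (m j) → EuclideanSpace ℝ (Fin n)),
        Function.Injective x → (∀ i, x i ∈ E) →
          MvPolynomial.aeval (fun p : Fin (m j) × Fin n => x p.1 p.2) (P j) ≠ (0 : ℝ) := by
  obtain ⟨G, hG⟩ := PerturbedGrid.exists_seq (n := n) hd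
  obtain ⟨N, E, hN, hEc, hEd, hE⟩ := PerturbedGrid.exists_isCompact_subset_cells G hn hd
  let e := EuclideanSpace.equiv (Fin n) ℝ
  refine ⟨e ⁻¹' E, e.toHomeomorph.isCompact_preimage.2 hEc, ?_, fun j x hx hxE => ?_⟩
  · rw [e.dimH_preimage, hEd]
  · exact hG N hN (m j) (P j) (hP j) (hdeg j) (fun i => e (x i)) (e.injective.comp hx)
      fun i k => hE k (hxE i)
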